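/- Let $k\ge 3$ and $\ell\ge 1$ be integers and let $a=\frac{k^k}{k^k-k!}$. For a finite simple graph $G$ with a (not necessarily proper) edge-coloring and a set $S\subseteq V(G)$, a rainbow $S$-tree is a subgraph of $G$ that is a tree, contains all vertices of $S$, and has no two edges of the same color. Rainbow $S$-trees $T_1,\dots,T_\ell$ are internally disjoint if $E(T_i)\cap E(T_j)=\emptyset$ and $V(T_i)\cap V(T_j)=S$ for all $i\ne j$. The $(k,\ell)$-rainbow index $rx_{k,\ell}(G)$ is the minimum number of colors in an edge-coloring of $G$ such that for every set $S$ of $k$ vertices of $G$ there exist $\ell$ internally disjoint rainbow $S$-trees (and $rx_{k,\ell}(G)=\infty$ if there is no such coloring). For integers $0\le M\le\binom n2$, let $G_{n,M}$ be a uniformly random graph among all graphs on $n$ labelled vertices with exactly $M$ edges. Then $M_0(n)=\sqrt[k]{n^{2k-1}\log_a n}$ is a sharp threshold function for the property $rx_{k,\ell}(G_{n,M})\le k$; that is, there are constants $c,C>0$ (which may depend on $k$ and $\ell$) such that for every sequence of integers $M(n)$ with $0\le M(n)\le\binom n2$ for all sufficiently large $n$: 1. if $M(n)\le c\,M_0(n)$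 for all sufficiently large $n$, then $\lim_{n\to\infty}\Pr[rx_{k,\ell}(G_{n,M(n)})\le k]=0$; 2. if $M(n)\ge C\,M_0(n)$ for all sufficiently large $n$, then $\lim_{n\to\infty}\Pr[rx_{k,\ell}(G_{n,M(n)})\le k]=1$. -/

import Mathlib

open Filter Topology

namespace RainbowIndex

/-- `T` is a rainbow `S`-tree of `G` under the edge-coloring `c`: a subgraph of `G` that is a tree,
contains all vertices of `S`, and has no two distinct edges of the same color. -/
def IsRainbowTree {V K : Type*} {G : SimpleGraph V} (c : G.edgeSet → K) (S : Set V)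
    (T : G.Subgraph) : Prop :=
  T.coe.IsTree ∧ S ⊆ T.verts ∧ Set.InjOn c {e : G.edgeSet | (e : Sym2 V) ∈ T.edgeSet}

/-- Under the edge-coloring `c` of `G`, for every set `S` of `k` vertices there are `ℓ` internally
disjoint rainbow `S`-trees: pairwise they share no edge, and share no vertices but those of `S`. -/
def IsRainbowColoring {V K : Type*} {G : SimpleGraph V} (k ℓ : ℕ) (c : G.edgeSet → K) : Prop :=
  ∀ S : Finset V, S.card = k →
    ∃ T : Fin ℓ → G.Subgraph,
      (∀ i, IsRainbowTree c (S : Set V) (T i)) ∧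
      ∀ i j, i ≠ j →
        Disjoint (T i).edgeSet (T j).edgeSet ∧ (T i).verts ∩ (T j).verts = (S : Set V)

/-- The `(k, ℓ)`-rainbow index of `G`: the least number `t` of colors for which some edge-coloring
of `G` with colors in `Fin t` provides `ℓ` internally disjoint rainbow `S`-trees for every set `S`
of `k` vertices. It is `⊤` if no number of colors suffices (for instance if `G` is
disconnected with at least `k ≥ 2` vertices and `ℓ ≥ 1`). -/
noncomputable def rainbowIndex {V : Type*} (k ℓ : ℕ) (G : SimpleGraph V) : ℕ∞ :=
  ⨅ (t : ℕ) (_ : ∃ c : G.edgeSet → Fin t, IsRainbowColoring k ℓ c), (t : ℕ∞)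

/-- The probability that the uniform random graph `G_{n,M}` satisfies `Q`: the proportion, among
all graphs on the vertex set `Fin n` with exactly `M` edges, of those satisfying `Q`. It is
meaningful for `M ≤ n.choose 2`, when there are such graphs. -/
noncomputable def probGnM (n M : ℕ) (Q : SimpleGraph (Fin n) → Prop) : ℝ :=
  ({G : SimpleGraph (Fin n) | G.edgeSet.ncard = M ∧ Q G}.ncard : ℝ) /
    ({G : SimpleGraph (Fin n) | G.edgeSet.ncard = M}.ncard : ℝ)

/-- `M₀` is a sharp threshold function for the graph property `Q` in the model `G(n, M)`: there are
constants `c, C > 0` such that `G_{n,M(n)}` almost surely does not satisfy `Q` whenever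
`M(n) ≤ c M₀(n)`, and almost surely satisfies `Q` whenever `M(n) ≥ C M₀(n)`. Here `M` ranges over
the admissible edge counts (`M n ≤ n.choose 2`), and the bounds need only hold for large `n`. -/
def IsSharpThresholdGnM (Q : ∀ n : ℕ, SimpleGraph (Fin n) → Prop) (M₀ : ℕ → ℝ) : Prop :=
  ∃ c C : ℝ, 0 < c ∧ 0 < C ∧
    (∀ M : ℕ → ℕ, (∀ᶠ n in atTop, M n ≤ n.choose 2) → (∀ᶠ n in atTop, (M n : ℝ) ≤ c * M₀ n) →
      Tendsto (fun n => probGnM n (M n) (fun G => ¬ Q n G)) atTop (𝓝 1)) ∧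
    (∀ M : ℕ → ℕ, (∀ᶠ n in atTop, M n ≤ n.choose 2) → (∀ᶠ n in atTop, C * M₀ n ≤ (M n : ℝ)) →
      Tendsto (fun n => probGnM n (M n) (Q n)) atTop (𝓝 1))

end RainbowIndex

namespace RainbowIndex

open Finset MeasureTheory ProbabilityTheory

/-! The property is sandwiched between two monotone ones. A rainbow tree in at most `k` colors has
at most `k + 1` vertices, so a rainbow `S`-tree with `|S| = k` has at most one vertex outside `S`.
If `S` is independent, each of its vertices has a tree neighbor outside `S`, so that one vertex is a
common neighbor of `S`: thus `HasIsolatedSet` excludes `k` colors. Conversely, `ℓ` rainbow stars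
with leaf set `S` and distinct centers are internally disjoint rainbow `S`-trees, so
`IsStarColorable` gives the index bound.

Both properties are studied for independent edges of probability `p`, where `p ^ k` is of order `log
n / n`, and carried to `M` edges by monotonicity. Above the threshold, edges get independent uniform
colors. For fixed `S`, an outer vertex is the center of a star with a prescribed rainbow pattern
with probability `(p / k) ^ k`. Splitting about `n` outer vertices into `ℓ` blocks and applying a
union bound over the `n ^ k` sets shows that all stars exist (`pi_real_not_isStarColorable_le`).

Below the threshold, take about `n ^ (1 / (4k))` disjoint `k`-sets. With high probability no edge
lies inside their union. The events that they have a common neighbor outside this union are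
independent, and each fails with probability at least `n ^ (-1 / (8k))`, so some set is isolated
(`pi_real_not_hasIsolatedSet_le`). The base `a` of the logarithm affects only the constants. -/

/-- Some colouring of the pairs of vertices with `k` colours has the property that every set of `k`
vertices is joined to `ℓ` distinct outer vertices by rainbow stars of `G`. -/
def IsStarColorable {V : Type*} (k ℓ : ℕ) (G : SimpleGraph V) : Prop :=
  ∃ χ : Sym2 V → Fin k, ∀ S : Finset V, S.card = k → ∃ w : Fin ℓ → V, Function.Injective w ∧
    ∀ i, w i ∉ S ∧ (∀ s ∈ S, G.Adj s (w i)) ∧ Set.InjOn (fun s => χ s(s, w i)) S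

/-- Some independent set of `k` vertices has no common neighbour. -/
def HasIsolatedSet {V : Type*} (k : ℕ) (G : SimpleGraph V) : Prop :=
  ∃ S : Finset V, S.card = k ∧ (∀ x ∈ S, ∀ y ∈ S, ¬ G.Adj x y) ∧ ∀ v, ∃ s ∈ S, ¬ G.Adj s v

/-! ### Rainbow stars and isolated sets versus the rainbow index -/

section Deterministic

variable {V : Type*} {k ℓ : ℕ} {G H : SimpleGraph V}

theorem IsStarColorable.mono (hGH : G ≤ H) (h : IsStarColorable k ℓ G) :
    IsStarColorable k ℓ H := by
  obtain ⟨χ, hχ⟩ := h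
  refine ⟨χ, fun S hS => ?_⟩
  obtain ⟨w, hw, h⟩ := hχ S hS
  exact ⟨w, hw, fun i => ⟨(h i).1, fun s hs => hGH ((h i).2.1 s hs), (h i).2.2⟩⟩

theorem HasIsolatedSet.anti (hGH : G ≤ H) (h : HasIsolatedSet k H) : HasIsolatedSet k G := by
  obtain ⟨S, hS, hind, hcom⟩ := h
  refine ⟨S, hS, fun x hx y hy hxy => hind x hx y hy (hGH hxy), fun v => ?_⟩
  obtain ⟨s, hs, hsv⟩ := hcom v
  exact ⟨s, hs, fun h => hsv (hGH h)⟩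

/-- The star of `G` with center `w` and set of leaves `S`. -/
def starSubgraph (G : SimpleGraph V) (S : Set V) (w : V) (h : ∀ s ∈ S, G.Adj s w) :
    G.Subgraph where
  verts := insert w S
  Adj x y := (x ∈ S ∧ y = w) ∨ (y ∈ S ∧ x = w)
  adj_sub := by
    rintro x y (⟨hx, rfl⟩ | ⟨hy, rfl⟩)
    · exact h _ hx
    · exact (h _ hy).symm
  edge_vert := by
    rintro x y (⟨hx, rfl⟩ | ⟨hy, rfl⟩)
    · exact Or.inr hx
    · exact Or.inl rfl
  symm := ⟨fun x y hxy => hxy.symm⟩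

theorem starSubgraph_coe_isTree {S : Set V} {w : V} (hw : w ∉ S) (h : ∀ s ∈ S, G.Adj s w) :
    (starSubgraph G S w h).coe.IsTree := by
  have : (starSubgraph G S w h).coe =
      SimpleGraph.starGraph (⟨w, Or.inl rfl⟩ : (starSubgraph G S w h).verts) := by
    ext ⟨x, hx⟩ ⟨y, hy⟩
    simp only [SimpleGraph.Subgraph.coe_adj, SimpleGraph.starGraph_adj, ne_eq, Subtype.mk.injEq]
    change (x ∈ S ∧ y = w) ∨ (y ∈ S ∧ x = w) ↔ _
    have hx' : x = w ∨ x ∈ S := hx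
    have hy' : y = w ∨ y ∈ S := hy
    grind
  rw [this]
  exact SimpleGraph.isTree_starGraph _

theorem mem_edgeSet_starSubgraph {S : Set V} {w : V} {h : ∀ s ∈ S, G.Adj s w} {e : Sym2 V} :
    e ∈ (starSubgraph G S w h).edgeSet ↔ ∃ s ∈ S, e = s(s, w) := by
  induction e with
  | _ x y =>
    rw [SimpleGraph.Subgraph.mem_edgeSet]
    change (x ∈ S ∧ y = w) ∨ (y ∈ S ∧ x = w) ↔ _
    simp only [Sym2.eq_iff]
    grind

theorem IsStarColorable.exists_isRainbowColoring (h : IsStarColorable k ℓ G) :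
    ∃ c : G.edgeSet → Fin k, IsRainbowColoring k ℓ c := by
  obtain ⟨χ, hχ⟩ := h
  refine ⟨fun e => χ e, fun S hS => ?_⟩
  obtain ⟨w, hw, h⟩ := hχ S hS
  refine ⟨fun i => starSubgraph G S (w i) (h i).2.1, fun i => ⟨?_, ?_, ?_⟩, fun i j hij => ⟨?_, ?_⟩⟩
  · exact starSubgraph_coe_isTree (by simpa using (h i).1) _
  · exact Set.subset_insert _ _
  · rintro ⟨e, he⟩ he' ⟨e', hee⟩ hee' hc
    obtain ⟨s, hs, rfl⟩ := mem_edgeSet_starSubgraph.1 he'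
    obtain ⟨t, ht, rfl⟩ := mem_edgeSet_starSubgraph.1 hee'
    have := (h i).2.2 hs ht hc
    subst this
    rfl
  · rw [Set.disjoint_left]
    intro e he he'
    obtain ⟨s, hs, rfl⟩ := mem_edgeSet_starSubgraph.1 he
    obtain ⟨t, ht, hst⟩ := mem_edgeSet_starSubgraph.1 he'
    have h1 := (h i).1
    have h2 := hw.ne hij
    rw [Sym2.eq_iff] at hst
    rcases hst with ⟨_, h3⟩ | ⟨_, h3⟩
    · exact h2 h3
    · exact h1 (h3 ▸ ht)
  · change insert (w i) (S : Set V) ∩ insert (w j) (S : Set V) = S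
    have h1 := (h i).1
    have h2 := hw.ne hij
    ext x
    simp only [Set.mem_inter_iff, Set.mem_insert_iff, Finset.mem_coe]
    grind

theorem IsStarColorable.rainbowIndex_le (h : IsStarColorable k ℓ G) : rainbowIndex k ℓ G ≤ k :=
  iInf₂_le k h.exists_isRainbowColoring

theorem exists_isRainbowColoring_of_rainbowIndex_le (h : rainbowIndex k ℓ G ≤ k) :
    ∃ t ≤ k, ∃ c : G.edgeSet → Fin t, IsRainbowColoring k ℓ c := by
  by_contra! hcon
  have : ((k + 1 : ℕ) : ℕ∞) ≤ rainbowIndex k ℓ G := by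
    refine le_iInf₂ fun t ⟨c, hc⟩ => ?_
    by_contra ht
    rw [Nat.cast_le] at ht
    exact hcon t (by omega) c hc
  have := this.trans h
  rw [Nat.cast_le] at this
  omega

/-- A tree has one edge fewer than vertices, and its edges inject into the `t` colors. -/
theorem IsRainbowTree.ncard_verts_le [Finite V] {t : ℕ} {c : G.edgeSet → Fin t} {S : Set V}
    {T : G.Subgraph} (hT : IsRainbowTree c S T) : T.verts.ncard ≤ t + 1 := by
  obtain ⟨htree, -, hinj⟩ := hT
  have hcard := (SimpleGraph.isTree_iff_connected_and_card.1 htree).2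
  rw [← Nat.card_coe_set_eq T.verts, ← hcard]
  have : Nat.card T.coe.edgeSet ≤ Nat.card (Fin t) := by
    have hmem : ∀ e : T.coe.edgeSet, Sym2.map Subtype.val (e : Sym2 T.verts) ∈ T.edgeSet := by
      rintro ⟨e, he⟩
      induction e with
      | _ x y => exact he
    refine Nat.card_le_card_of_injective
      (fun e : T.coe.edgeSet => c ⟨Sym2.map Subtype.val (e : Sym2 T.verts),
        T.edgeSet_subset (hmem e)⟩) ?_
    intro e e' hee
    have := hinj (hmem e) (hmem e') hee
    exact Subtype.ext (Sym2.map.injective Subtype.val_injective (congrArg Subtype.val this))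
  simpa using this

theorem HasIsolatedSet.lt_rainbowIndex [Finite V] (hk : 2 ≤ k) (hℓ : 1 ≤ ℓ)
    (h : HasIsolatedSet k G) : ¬ rainbowIndex k ℓ G ≤ k := by
  intro hle
  obtain ⟨t, ht, c, hc⟩ := exists_isRainbowColoring_of_rainbowIndex_le hle
  obtain ⟨S, hS, hind, hcom⟩ := h
  obtain ⟨T, hT, -⟩ := hc S hS
  set T₀ := T ⟨0, hℓ⟩
  have hT₀ : IsRainbowTree c S T₀ := hT _
  have hcard := hT₀.ncard_verts_le
  obtain ⟨htree, hST, -⟩ := hT₀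
  -- At most `t + 1 ≤ k + 1` vertices, of which `k` are in `S`.
  have hout : (T₀.verts \ S).ncard ≤ 1 := by
    have := Set.ncard_sdiff_add_ncard_of_subset hST
    rw [Set.ncard_coe_finset] at this
    omega
  have hnb : ∀ s ∈ S, ∃ w ∈ T₀.verts \ S, G.Adj s w := by
    intro s hs
    obtain ⟨s', hs', hne⟩ := Finset.exists_mem_ne (by omega : 1 < S.card) s
    have : Nontrivial T₀.verts := ⟨⟨s, hST hs⟩, ⟨s', hST hs'⟩, fun h => hne (by simpa using h.symm)⟩
    obtain ⟨w, hw⟩ := htree.1.preconnected.exists_adj_of_nontrivial ⟨s, hST hs⟩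
    have hadj : G.Adj s w := T₀.adj_sub hw
    exact ⟨w, ⟨w.2, fun hwS => hind s hs w hwS hadj⟩, hadj⟩
  obtain ⟨s₀, hs₀⟩ := Finset.card_pos.1 (by omega : 0 < S.card)
  obtain ⟨w, hw, -⟩ := hnb s₀ hs₀
  obtain ⟨s, hs, hsw⟩ := hcom w
  obtain ⟨w', hw', hsw'⟩ := hnb s hs
  exact hsw ((Set.ncard_le_one (Set.toFinite _)).1 hout w' hw' w hw ▸ hsw')

end Deterministic

/-! ### Comparison of the uniform and binomial models for decreasing properties -/

section LevelDensity

variable {E : Type*} [Fintype E]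

open scoped Classical in
/-- The proportion of sets satisfying `B` among the sets of size `r`. -/
noncomputable def levelDensity (B : Finset E → Prop) (r : ℕ) : ℝ :=
  (#{F ∈ powersetCard r univ | B F} : ℝ) / (Fintype.card E).choose r

theorem levelDensity_nonneg (B : Finset E → Prop) (r : ℕ) : 0 ≤ levelDensity B r := by
  unfold levelDensity; positivity

theorem levelDensity_le_one (B : Finset E → Prop) (r : ℕ) : levelDensity B r ≤ 1 := by
  classical
  unfold levelDensity
  refine div_le_one_of_le₀ ?_ (by positivity)
  have := card_filter_le (powersetCard r (univ : Finset E)) B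
  rw [card_powersetCard, card_univ] at this
  exact_mod_cast this

theorem levelDensity_add_not (B : Finset E → Prop) {r : ℕ} (hr : r ≤ Fintype.card E) :
    levelDensity B r + levelDensity (fun F => ¬ B F) r = 1 := by
  classical
  have h := card_filter_add_card_filter_not (s := powersetCard r (univ : Finset E)) B
  rw [card_powersetCard, card_univ] at h
  have hpos : 0 < (Fintype.card E).choose r := Nat.choose_pos hr
  unfold levelDensity
  rw [← add_div, div_eq_one_iff_eq (by positivity), ← h]
  push_cast
  congr!

theorem levelDensity_mono {B B' : Finset E → Prop} (h : ∀ F, B F → B' F) (r : ℕ) :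
    levelDensity B r ≤ levelDensity B' r := by
  classical
  unfold levelDensity
  gcongr
  exact h _

/-- Since `B` is decreasing, the shadow of its sets of size `r + 1` lies among its sets of size `r`;
the local LYM inequality compares the two densities. -/
theorem levelDensity_succ_le {B : Finset E → Prop} (hB : ∀ F F', F ⊆ F' → B F' → B F) (r : ℕ) :
    levelDensity B (r + 1) ≤ levelDensity B r := by
  classical
  unfold levelDensity
  set 𝒜 : Finset (Finset E) := {F ∈ powersetCard (r + 1) univ | B F}
  have hsized : (𝒜 : Set (Finset E)).Sized (r + 1) := by
    intro F hF
    have : F ∈ 𝒜 := hF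
    simp only [𝒜, mem_filter, mem_powersetCard] at this
    exact this.1.2
  refine (local_lubell_yamamoto_meshalkin_inequality_div (𝕜 := ℝ) r.succ_ne_zero hsized).trans ?_
  rw [Nat.succ_sub_one]
  gcongr
  intro F hF
  obtain ⟨F', hF', hcard⟩ := mem_shadow_iff_exists_sdiff.1 hF
  simp only [mem_filter, mem_powersetCard, subset_univ, true_and]
  exact ⟨by simpa using hsized.shadow hF, hB F F' hcard.1 (mem_filter.1 hF').2⟩

theorem levelDensity_antitone {B : Finset E → Prop} (hB : ∀ F F', F ⊆ F' → B F' → B F) :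
    Antitone (levelDensity B) :=
  antitone_nat_of_succ_le (levelDensity_succ_le hB)

open scoped Classical in
/-- The probability that a random set satisfies `B` if it contains every element independently with
probability `p`. -/
noncomputable def binomialProb (p : ℝ) (B : Finset E → Prop) : ℝ :=
  ∑ F with B F, p ^ #F * (1 - p) ^ (Fintype.card E - #F)

/-- The probability that a binomial variable with parameters `N` and `p` equals `r`. -/
noncomputable def binomialWeight (N : ℕ) (p : ℝ) (r : ℕ) : ℝ := N.choose r * p ^ r * (1 - p) ^ (N - r)

theorem binomialWeight_nonneg {p : ℝ} (hp : 0 ≤ p) (hp1 : p ≤ 1) (N r : ℕ) :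
    0 ≤ binomialWeight N p r := by
  have : 0 ≤ 1 - p := by linarith
  unfold binomialWeight; positivity

theorem sum_binomialWeight_mul_pow (N : ℕ) (p x : ℝ) :
    ∑ r ∈ range (N + 1), binomialWeight N p r * x ^ r = (p * x + (1 - p)) ^ N := by
  rw [add_pow]
  refine sum_congr rfl fun r _ => ?_
  unfold binomialWeight
  ring

theorem sum_binomialWeight (N : ℕ) (p : ℝ) : ∑ r ∈ range (N + 1), binomialWeight N p r = 1 := by
  simpa using sum_binomialWeight_mul_pow N p 1

/-- Conditioned on its size, the binomial random set is uniform. -/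
theorem binomialProb_eq_sum (p : ℝ) (B : Finset E → Prop) :
    binomialProb p B =
      ∑ r ∈ range (Fintype.card E + 1), binomialWeight (Fintype.card E) p r * levelDensity B r := by
  classical
  unfold binomialProb
  rw [sum_filter, ← powerset_univ, sum_powerset, card_univ]
  refine sum_congr rfl fun r hr => ?_
  have hpos : 0 < (Fintype.card E).choose r :=
    Nat.choose_pos (Nat.lt_succ_iff.1 (mem_range.1 hr))
  have : ∀ F ∈ powersetCard r (univ : Finset E),
      (if B F then p ^ #F * (1 - p) ^ (Fintype.card E - #F) else 0) =
        if B F then p ^ r * (1 - p) ^ (Fintype.card E - r) else 0 := by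
    intro F hF
    rw [(mem_powersetCard.1 hF).2]
  rw [sum_congr rfl this, ← sum_filter, sum_const, nsmul_eq_mul]
  unfold binomialWeight levelDensity
  field_simp

theorem binomialProb_add_not (p : ℝ) (B : Finset E → Prop) :
    binomialProb p B + binomialProb p (fun F => ¬ B F) = 1 := by
  rw [binomialProb_eq_sum, binomialProb_eq_sum, ← sum_add_distrib,
    ← sum_binomialWeight (Fintype.card E) p]
  refine sum_congr rfl fun r hr => ?_
  rw [← mul_add, levelDensity_add_not _ (Nat.lt_succ_iff.1 (mem_range.1 hr)), mul_one]

/-- Let `X` be the binomial size. Sizes up to `M` have density at least that of level `M`, so it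
suffices that `X ≤ M` with probability at least `1/2`. Markov's inequality for `2 ^ X` gives this.
It is applied termwise: the factor `1 - 2 ^ r / 2 ^ (M + 1)` is at most `1` for `r ≤ M` and
nonpositive beyond. -/
theorem levelDensity_le_two_mul_binomialProb {B : Finset E → Prop}
    (hB : ∀ F F', F ⊆ F' → B F' → B F) {p : ℝ} (hp : 0 ≤ p) (hp1 : p ≤ 1) {M : ℕ}
    (hM : 2 * (Fintype.card E * p) ≤ M) :
    levelDensity B M ≤ 2 * binomialProb p B := by
  set N := Fintype.card E
  have key : ∑ r ∈ range (N + 1), levelDensity B M *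
      (binomialWeight N p r - binomialWeight N p r * 2 ^ r / 2 ^ (M + 1)) ≤ binomialProb p B := by
    rw [binomialProb_eq_sum]
    refine sum_le_sum fun r _ => ?_
    have hb := binomialWeight_nonneg hp hp1 N r
    have h0 := levelDensity_nonneg B M
    rcases le_or_gt r M with hr | hr
    · rw [mul_comm]
      have h1 : 0 ≤ binomialWeight N p r * 2 ^ r / 2 ^ (M + 1) := by positivity
      exact mul_le_mul (by linarith) (levelDensity_antitone hB hr) h0 hb
    · have h1 : binomialWeight N p r ≤ binomialWeight N p r * 2 ^ r / 2 ^ (M + 1) := by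
        rw [mul_div_assoc]
        refine le_mul_of_one_le_right hb ?_
        rw [one_le_div (by positivity)]
        exact pow_le_pow_right₀ (by norm_num) hr
      exact (mul_nonpos_of_nonneg_of_nonpos h0 (by linarith)).trans
        (mul_nonneg hb (levelDensity_nonneg B r))
  rw [← mul_sum, sum_sub_distrib, sum_binomialWeight, ← sum_div, sum_binomialWeight_mul_pow] at key
  have hexp : (p * 2 + (1 - p)) ^ N ≤ 2 ^ M := by
    calc (p * 2 + (1 - p)) ^ N ≤ (Real.exp p) ^ N := by
          gcongr
          · linarith [Real.add_one_le_exp p]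
      _ = Real.exp (N * p) := by rw [Real.exp_nat_mul]
      _ ≤ Real.exp (M * (1 / 2)) := by
          apply Real.exp_le_exp.2
          linarith
      _ = (Real.exp (1 / 2)) ^ M := by rw [Real.exp_nat_mul]
      _ ≤ 2 ^ M := by
          gcongr
          have h1 : Real.exp (1 / 2) ^ 2 = Real.exp 1 := by
            rw [← Real.exp_nat_mul]; norm_num
          have h2 := Real.exp_one_lt_d9
          nlinarith [Real.exp_pos (1 / 2)]
  have hhalf : (p * 2 + (1 - p)) ^ N / 2 ^ (M + 1) ≤ 1 / 2 := by
    rw [div_le_div_iff₀ (by positivity) (by norm_num), pow_succ]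
    linarith
  nlinarith [levelDensity_nonneg B M]

/-- The mirror image: sizes from `M` upwards have density at most that of level `M`, and Markov's
inequality for `2 ^ (-X)` shows that `X < M` has probability at most `1/2`. -/
theorem one_sub_levelDensity_le_two_mul {B : Finset E → Prop}
    (hB : ∀ F F', F ⊆ F' → B F' → B F) {p : ℝ} (hp : 0 ≤ p) (hp1 : p ≤ 1) {M : ℕ}
    (hM : 4 * (M : ℝ) ≤ Fintype.card E * p) :
    1 - levelDensity B M ≤ 2 * (1 - binomialProb p B) := by
  set N := Fintype.card E
  have key : ∑ r ∈ range (N + 1), (1 - levelDensity B M) *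
      (binomialWeight N p r - binomialWeight N p r * (1 / 2) ^ r * (2 ^ M / 2)) ≤
        1 - binomialProb p B := by
    rw [binomialProb_eq_sum]
    nth_rw 3 [← sum_binomialWeight N p]
    rw [← sum_sub_distrib]
    refine sum_le_sum fun r _ => ?_
    rw [← mul_one_sub]
    have hb := binomialWeight_nonneg hp hp1 N r
    have h0 : 0 ≤ 1 - levelDensity B M := sub_nonneg.2 (levelDensity_le_one B M)
    rcases le_or_gt M r with hr | hr
    · rw [mul_comm]
      have h1 : 0 ≤ binomialWeight N p r * (1 / 2) ^ r * (2 ^ M / 2) := by positivity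
      exact mul_le_mul (by linarith) (by linarith [levelDensity_antitone hB hr]) h0 hb
    · have h1 : binomialWeight N p r ≤ binomialWeight N p r * (1 / 2) ^ r * (2 ^ M / 2) := by
        rw [mul_assoc]
        refine le_mul_of_one_le_right hb ?_
        obtain ⟨d, rfl⟩ := Nat.exists_eq_add_of_lt hr
        have : (1 / 2 : ℝ) ^ r * (2 ^ (r + d + 1) / 2) = 2 ^ d := by
          rw [pow_succ, pow_add, one_div, inv_pow]
          field_simp
        rw [this]
        exact one_le_pow₀ (by norm_num)
      exact (mul_nonpos_of_nonneg_of_nonpos h0 (by linarith)).trans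
        (mul_nonneg hb (sub_nonneg.2 (levelDensity_le_one B r)))
  rw [← mul_sum, sum_sub_distrib, sum_binomialWeight, ← sum_mul, sum_binomialWeight_mul_pow] at key
  have hexp : (p * (1 / 2) + (1 - p)) ^ N * 2 ^ M ≤ 1 := by
    calc (p * (1 / 2) + (1 - p)) ^ N * 2 ^ M ≤ (Real.exp (-(p / 2))) ^ N * (Real.exp 1) ^ M := by
          gcongr
          · linarith [Real.add_one_le_exp (-(p / 2))]
          · linarith [Real.add_one_le_exp (1 : ℝ)]
      _ = Real.exp (N * (-(p / 2)) + M * 1) := by rw [Real.exp_add, Real.exp_nat_mul, Real.exp_nat_mul]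
      _ ≤ 1 := by
          rw [Real.exp_le_one_iff]
          have : (0 : ℝ) ≤ M := by positivity
          linarith
  nlinarith [levelDensity_le_one B M]

end LevelDensity

/-! ### Graphs as sets of edge slots -/

section Graphs

/-- The possible edges of a graph on `Fin n`. -/
abbrev EdgeSlot (n : ℕ) : Type := {e : Sym2 (Fin n) // ¬ e.IsDiag}

/-- The graph with a given set of edges. -/
def graphOfEdges {n : ℕ} (F : Finset (EdgeSlot n)) : SimpleGraph (Fin n) :=
  SimpleGraph.fromEdgeSet (Subtype.val '' (F : Set (EdgeSlot n)))

theorem edgeSet_graphOfEdges {n : ℕ} (F : Finset (EdgeSlot n)) :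
    (graphOfEdges F).edgeSet = Subtype.val '' (F : Set (EdgeSlot n)) := by
  rw [graphOfEdges, SimpleGraph.edgeSet_fromEdgeSet, sdiff_eq_left, Set.disjoint_left]
  rintro _ ⟨e, -, rfl⟩ he
  exact e.2 he

theorem graphOfEdges_injective (n : ℕ) : Function.Injective (graphOfEdges (n := n)) := by
  intro F F' h
  have := congrArg SimpleGraph.edgeSet h
  rw [edgeSet_graphOfEdges, edgeSet_graphOfEdges] at this
  exact Finset.coe_injective (Subtype.val_injective.image_injective this)

theorem graphOfEdges_surjective (n : ℕ) : Function.Surjective (graphOfEdges (n := n)) := by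
  classical
  intro G
  refine ⟨univ.filter fun e => (e : Sym2 (Fin n)) ∈ G.edgeSet, ?_⟩
  rw [← SimpleGraph.edgeSet_inj, edgeSet_graphOfEdges]
  ext e
  constructor
  · rintro ⟨x, hx, rfl⟩
    simpa using hx
  · intro h
    exact ⟨⟨e, G.not_isDiag_of_mem_edgeSet h⟩, by simpa using h, rfl⟩

theorem graphOfEdges_mono {n : ℕ} {F F' : Finset (EdgeSlot n)} (h : F ⊆ F') :
    graphOfEdges F ≤ graphOfEdges F' :=
  SimpleGraph.fromEdgeSet_mono (Set.image_mono (Finset.coe_subset.2 h))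

theorem ncard_edgeSet_graphOfEdges {n : ℕ} (F : Finset (EdgeSlot n)) :
    (graphOfEdges F).edgeSet.ncard = #F := by
  rw [edgeSet_graphOfEdges, Set.ncard_image_of_injective _ Subtype.val_injective,
    Set.ncard_coe_finset]

theorem card_edgeSlot (n : ℕ) : Fintype.card (EdgeSlot n) = n.choose 2 := by
  rw [Sym2.card_subtype_not_diag, Fintype.card_fin]

open scoped Classical in
theorem ncard_graphs_eq (n M : ℕ) (Q : SimpleGraph (Fin n) → Prop) :
    {G : SimpleGraph (Fin n) | G.edgeSet.ncard = M ∧ Q G}.ncard =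
      #{F ∈ powersetCard M (univ : Finset (EdgeSlot n)) | Q (graphOfEdges F)} := by
  rw [← Set.ncard_coe_finset, ← Set.ncard_image_of_injective _ (graphOfEdges_injective n)]
  congr 1
  ext G
  obtain ⟨F, rfl⟩ := graphOfEdges_surjective n G
  rw [(graphOfEdges_injective n).mem_set_image]
  simp [ncard_edgeSet_graphOfEdges]

theorem probGnM_eq_levelDensity (n M : ℕ) (Q : SimpleGraph (Fin n) → Prop) :
    probGnM n M Q = levelDensity (fun F => Q (graphOfEdges F)) M := by
  classical
  have h : {G : SimpleGraph (Fin n) | G.edgeSet.ncard = M}.ncard = (n.choose 2).choose M := by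
    have := ncard_graphs_eq n M (fun _ => True)
    simpa only [and_true, filter_true, card_powersetCard, card_univ, card_edgeSlot] using this
  unfold probGnM levelDensity
  rw [ncard_graphs_eq, h, card_edgeSlot]

end Graphs

/-! ### Independence under a product measure on a finite set of labels -/

section ProductMeasure

variable {E I X : Type*} [Fintype E] [Fintype I] [Finite X] [MeasurableSpace X]
  [MeasurableSingletonClass X] (ν : Measure X) [IsProbabilityMeasure ν]

/-- Events that depend on disjoint sets of coordinates are independent. -/
theorem pi_real_inter {b c : Finset E} (hbc : Disjoint b c) {D D' : Set (E → X)}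
    (hD : ∀ f g, (∀ e ∈ b, f e = g e) → f ∈ D → g ∈ D)
    (hD' : ∀ f g, (∀ e ∈ c, f e = g e) → f ∈ D' → g ∈ D') :
    (Measure.pi fun _ : E => ν).real (D ∩ D') =
      (Measure.pi fun _ : E => ν).real D * (Measure.pi fun _ : E => ν).real D' := by
  have h1 : iIndepFun (fun (e : E) (f : E → X) => f e) (Measure.pi fun _ : E => ν) :=
    iIndepFun_pi (X := fun _ => id) fun _ => aemeasurable_id
  have h2 := (h1.indepFun_finset b c hbc fun e => measurable_pi_apply e).measure_inter_preimage_eq_mul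
    ((fun (f : E → X) (e : b) => f e) '' D) ((fun (f : E → X) (e : c) => f e) '' D')
    (Set.toFinite _).measurableSet (Set.toFinite _).measurableSet
  -- An event determined by the coordinates in `a` is the preimage of its image under restriction to
  -- `a`.
  have h3 : ∀ {a : Finset E} {C : Set (E → X)},
      (∀ f g, (∀ e ∈ a, f e = g e) → f ∈ C → g ∈ C) →
      (fun (f : E → X) (e : a) => f e) ⁻¹' ((fun (f : E → X) (e : a) => f e) '' C) = C := by
    intro a C hC
    refine Set.Subset.antisymm ?_ (Set.subset_preimage_image _ _)
    rintro g ⟨f, hf, hfg⟩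
    exact hC f g (fun e he => congrFun hfg ⟨e, he⟩) hf
  rw [h3 hD, h3 hD'] at h2
  rw [measureReal_def, h2, ENNReal.toReal_mul]
  rfl

/-- Events that depend on pairwise disjoint sets of coordinates are independent. -/
theorem pi_real_iInter (b : I → Finset E) (hb : Pairwise fun i j => Disjoint (b i) (b j))
    (D : I → Set (E → X))
    (hD : ∀ i f g, (∀ e ∈ b i, f e = g e) → f ∈ D i → g ∈ D i) :
    (Measure.pi fun _ : E => ν).real (⋂ i, D i) =
      ∏ i, (Measure.pi fun _ : E => ν).real (D i) := by
  classical
  have key : ∀ s : Finset I, (Measure.pi fun _ : E => ν).real (⋂ i ∈ s, D i) =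
      ∏ i ∈ s, (Measure.pi fun _ : E => ν).real (D i) := by
    intro s
    induction s using Finset.induction_on with
    | empty => simp
    | insert i s hi ih =>
      rw [set_biInter_insert, prod_insert hi, ← ih]
      refine pi_real_inter ν (b := b i) (c := s.biUnion b) ?_ (hD i) ?_
      · rw [disjoint_biUnion_right]
        exact fun j hj => hb fun hij => hi (hij ▸ hj)
      · intro f g hfg hf
        simp only [Set.mem_iInter] at hf ⊢
        exact fun j hj => hD j f g (fun e he => hfg e (mem_biUnion.2 ⟨j, hj, he⟩)) (hf j hj)
  simpa using key univ

theorem pi_real_eval (e : E) (B : Set X) :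
    (Measure.pi fun _ : E => ν).real {f | f e ∈ B} = ν.real B := by
  have h := (measurePreserving_eval (fun _ : E => ν) e).measure_preimage
    (Set.toFinite B).measurableSet.nullMeasurableSet
  rw [measureReal_def, measureReal_def, ← h]
  rfl

theorem pi_real_forall_mem {e : I → E} (he : Function.Injective e) (B : I → Set X) :
    (Measure.pi fun _ : E => ν).real {f | ∀ i, f (e i) ∈ B i} = ∏ i, ν.real (B i) := by
  have h := pi_real_iInter ν (fun i => {e i})
    (fun i j hij => by simpa using he.ne hij) (fun i => {f | f (e i) ∈ B i})
    (fun i f g hfg hf => by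
      have := hfg (e i) (mem_singleton_self _)
      change g (e i) ∈ B i
      rw [← this]; exact hf)
  simp only [pi_real_eval] at h
  rw [← h]
  congr 1
  ext f
  simp

theorem pi_real_compl (D : Set (E → X)) :
    (Measure.pi fun _ : E => ν).real Dᶜ = 1 - (Measure.pi fun _ : E => ν).real D :=
  probReal_compl_eq_one_sub (Set.toFinite D).measurableSet

end ProductMeasure

/-! ### The random graph read off from independent labels -/

section RandomGraph

variable {X : Type*} {n : ℕ}

/-- The graph whose edges are the pairs of distinct vertices with label in `A`. -/
def labelGraph (A : Set X) (f : Sym2 (Fin n) → X) : SimpleGraph (Fin n) :=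
  SimpleGraph.fromEdgeSet {e | f e ∈ A}

theorem labelGraph_adj {A : Set X} {f : Sym2 (Fin n) → X} {x y : Fin n} :
    (labelGraph A f).Adj x y ↔ f s(x, y) ∈ A ∧ x ≠ y :=
  SimpleGraph.fromEdgeSet_adj _

open scoped Classical in
theorem labelGraph_eq_graphOfEdges (A : Set X) (f : Sym2 (Fin n) → X) :
    labelGraph A f = graphOfEdges {e : EdgeSlot n | f e ∈ A} := by
  rw [← SimpleGraph.edgeSet_inj, edgeSet_graphOfEdges, labelGraph,
    SimpleGraph.edgeSet_fromEdgeSet]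
  ext e
  constructor
  · rintro ⟨he, hd⟩
    exact ⟨⟨e, hd⟩, by simpa using he, rfl⟩
  · rintro ⟨e, he, rfl⟩
    exact ⟨by simpa using he, e.2⟩

variable [Finite X] [MeasurableSpace X] [MeasurableSingletonClass X] (ν : Measure X)
  [IsProbabilityMeasure ν]

/-- Sum over the possible edge sets; labels of diagonal pairs are free and contribute a factor `1`.
-/
theorem pi_real_labelGraph (A : Set X) (Q : SimpleGraph (Fin n) → Prop) :
    (Measure.pi fun _ : Sym2 (Fin n) => ν).real {f | Q (labelGraph A f)} =
      binomialProb (ν.real A) fun F => Q (graphOfEdges F) := by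
  classical
  set μ := Measure.pi fun _ : Sym2 (Fin n) => ν
  have hset : {f | Q (labelGraph A f)} = ⋃ F ∈ univ.filter fun F => Q (graphOfEdges F),
      {f | (univ.filter fun e : EdgeSlot n => f e ∈ A) = F} := by
    ext f
    simp [labelGraph_eq_graphOfEdges]
  rw [hset, measureReal_biUnion_finset]
  · refine sum_congr rfl fun F _ => ?_
    have hF : {f : Sym2 (Fin n) → X | (univ.filter fun e : EdgeSlot n => f e ∈ A) = F} =
        {f | ∀ e : EdgeSlot n, f e ∈ if e ∈ F then A else Aᶜ} := by
      ext f
      change _ = _ ↔ ∀ e : EdgeSlot n, _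
      rw [Finset.ext_iff]
      refine forall_congr' fun e => ?_
      by_cases he : e ∈ F <;> simp [he]
    rw [hF, pi_real_forall_mem ν Subtype.val_injective]
    have hite : ∀ e : EdgeSlot n, ν.real (if e ∈ F then A else Aᶜ) =
        if e ∈ F then ν.real A else 1 - ν.real A := by
      intro e
      split_ifs
      · rfl
      · exact probReal_compl_eq_one_sub (Set.toFinite A).measurableSet
    rw [prod_congr rfl fun e _ => hite e, prod_ite, prod_const, prod_const, filter_not, ← compl_eq_univ_sdiff,
      card_compl]
    simp
  · intro F _ F' _ hne
    rw [Function.onFun, Set.disjoint_left]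
    rintro f hf hf'
    exact hne (Eq.trans (Eq.symm hf) hf')
  · exact fun F _ => (Set.toFinite _).measurableSet

end RandomGraph

theorem sym2_mk_left_injective {V : Type*} (w : V) : Function.Injective fun s : V => s(s, w) :=
  fun _ _ h => Sym2.congr_left.1 h

/-! ### Rainbow stars exist above the threshold -/

section Upper

variable {n k ℓ m : ℕ} (ν : Measure (Bool × Fin k)) [IsProbabilityMeasure ν]

theorem pi_real_no_stars_le {q : ℝ} (hν : ∀ c, ν.real {(true, c)} = q) {S : Finset (Fin n)}
    (hS : #S = k) (hn : k + ℓ * m ≤ n) {σ : Fin n → Fin k} :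
    (Measure.pi fun _ : Sym2 (Fin n) => ν).real {f | ¬ ∃ w : Fin ℓ → Fin n, Function.Injective w ∧
      ∀ i, w i ∉ S ∧ ∀ s ∈ S, f s(s, w i) = (true, σ s)} ≤ ℓ * (1 - q ^ k) ^ m := by
  classical
  set μ := Measure.pi fun _ : Sym2 (Fin n) => ν
  -- Disjoint blocks of `m` candidate centers, one block per star: centers from different blocks are
  -- automatically distinct, and failure means that some block contains no center.
  obtain ⟨g⟩ : Nonempty (Fin ℓ × Fin m ↪ (Sᶜ : Finset (Fin n))) := by
    rw [Function.Embedding.nonempty_iff_card_le]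
    simp only [Fintype.card_prod, Fintype.card_fin, Fintype.card_coe, card_compl, hS]
    omega
  have hg : ∀ x, (g x : Fin n) ∉ S := fun x => mem_compl.1 (g x).2
  have hginj : ∀ {x y}, (g x : Fin n) = g y → x = y := fun h => g.injective (Subtype.ext h)
  have hsub : {f : Sym2 (Fin n) → Bool × Fin k | ¬ ∃ w : Fin ℓ → Fin n, Function.Injective w ∧
      ∀ i, w i ∉ S ∧ ∀ s ∈ S, f s(s, w i) = (true, σ s)} ⊆
      ⋃ j ∈ (univ : Finset (Fin ℓ)), ⋂ i : Fin m,
        {f | ∀ s : S, f s((s : Fin n), (g (j, i) : Fin n)) ∈ ({(true, σ s)} : Set _)}ᶜ := by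
    intro f hf
    by_contra hcon
    simp only [mem_univ, Set.iUnion_true, Set.mem_iUnion, Set.mem_iInter, Set.mem_compl_iff,
      not_exists, not_forall, not_not] at hcon
    choose i hi using hcon
    refine hf ⟨fun j => g (j, i j), fun j j' h => congrArg Prod.fst (hginj h), fun j => ⟨hg _, ?_⟩⟩
    exact fun s hs => hi j ⟨s, hs⟩
  have hone : ∀ j : Fin ℓ, μ.real (⋂ i : Fin m,
      {f | ∀ s : S, f s((s : Fin n), (g (j, i) : Fin n)) ∈ ({(true, σ s)} : Set _)}ᶜ) =
      (1 - q ^ k) ^ m := by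
    intro j
    rw [pi_real_iInter ν fun i => S.image fun s => s(s, (g (j, i) : Fin n))]
    · have : ∀ i : Fin m, μ.real
          {f | ∀ s : S, f s((s : Fin n), (g (j, i) : Fin n)) ∈ ({(true, σ s)} : Set _)} = q ^ k := by
        intro i
        rw [pi_real_forall_mem ν
          (e := fun s : S => s((s : Fin n), (g (j, i) : Fin n)))
          ((sym2_mk_left_injective _).comp Subtype.val_injective)]
        simp [hν, hS]
      simp only [pi_real_compl]
      rw [prod_congr rfl fun i _ => congrArg (1 - ·) (this i)]
      simp
    · intro i i' hii
      rw [disjoint_left]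
      intro e he he'
      obtain ⟨s, hs, rfl⟩ := mem_image.1 he
      obtain ⟨t, ht, hst⟩ := mem_image.1 he'
      rcases Sym2.eq_iff.1 hst with ⟨_, h⟩ | ⟨h, _⟩
      · exact hii (congrArg Prod.snd (hginj h)).symm
      · exact hg _ (h ▸ ht)
    · intro i f f' hff hf hf'
      refine hf fun s => ?_
      rw [hff _ (mem_image_of_mem _ s.2)]
      exact hf' s
  calc _ ≤ μ.real (⋃ j ∈ (univ : Finset (Fin ℓ)), ⋂ i : Fin m,
        {f | ∀ s : S, f s((s : Fin n), (g (j, i) : Fin n)) ∈ ({(true, σ s)} : Set _)}ᶜ) :=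
        measureReal_mono hsub (measure_ne_top _ _)
    _ ≤ ∑ j : Fin ℓ, (1 - q ^ k) ^ m := by
        refine (measureReal_biUnion_finset_le _ _).trans_eq ?_
        exact sum_congr rfl fun j _ => hone j
    _ = _ := by simp

theorem pi_real_not_isStarColorable_le {q : ℝ} (hν : ∀ c, ν.real {(true, c)} = q)
    (hn : k + ℓ * m ≤ n) (hk : 0 < k) :
    (Measure.pi fun _ : Sym2 (Fin n) => ν).real
      {f | ¬ IsStarColorable k ℓ (labelGraph (Prod.fst ⁻¹' {true}) f)} ≤
      (n : ℝ) ^ k * (ℓ * (1 - q ^ k) ^ m) := by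
  classical
  set μ := Measure.pi fun _ : Sym2 (Fin n) => ν
  -- Only one fixed rainbow pattern per `S` is sought; ignoring the other `k! - 1` patterns costs
  -- only a constant factor in the threshold.
  have hσ : ∀ S : Finset (Fin n), ∃ σ : Fin n → Fin k, #S = k → Set.InjOn σ S := by
    intro S
    by_cases hS : #S = k
    · have : Fintype.card S = k := by simpa using hS
      let e := Fintype.equivFinOfCardEq this
      refine ⟨fun s => if h : s ∈ S then e ⟨s, h⟩ else ⟨0, hk⟩, fun _ s hs t ht hst => ?_⟩
      rw [mem_coe] at hs ht
      simp only [hs, ht, dif_pos] at hst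
      simpa using hst
    · exact ⟨fun _ => ⟨0, hk⟩, fun h => absurd h hS⟩
  choose σ hσ using hσ
  have hq : q ≤ 1 := by
    rw [← hν ⟨0, hk⟩]; exact measureReal_le_one
  have hq0 : 0 ≤ q := by
    rw [← hν ⟨0, hk⟩]; exact measureReal_nonneg
  have hnonneg : 0 ≤ 1 - q ^ k := sub_nonneg.2 (pow_le_one₀ hq0 hq)
  have hsub : {f | ¬ IsStarColorable k ℓ (labelGraph (Prod.fst ⁻¹' {true}) f)} ⊆
      ⋃ S ∈ powersetCard k (univ : Finset (Fin n)),
        {f : Sym2 (Fin n) → Bool × Fin k | ¬ ∃ w : Fin ℓ → Fin n, Function.Injective w ∧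
          ∀ i, w i ∉ S ∧ ∀ s ∈ S, f s(s, w i) = (true, σ S s)} := by
    intro f hf
    by_contra hcon
    simp only [Set.mem_iUnion, not_exists, mem_powersetCard, subset_univ, true_and] at hcon
    refine hf ⟨fun e => (f e).2, fun S hS => ?_⟩
    have hS' := hcon S hS
    rw [Set.notMem_ofPred_iff, not_forall_not] at hS'
    obtain ⟨w, hw, h⟩ := hS'
    refine ⟨w, hw, fun i => ⟨(h i).1, fun s hs => ?_, fun s hs t ht hst => ?_⟩⟩
    · rw [labelGraph_adj, (h i).2 s hs]
      exact ⟨rfl, fun hsw => (h i).1 (hsw ▸ hs)⟩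
    · have hst' : (f s(s, w i)).2 = (f s(t, w i)).2 := hst
      rw [(h i).2 s hs, (h i).2 t ht] at hst'
      exact hσ S hS hs ht hst'
  calc _ ≤ _ := measureReal_mono hsub (measure_ne_top _ _)
    _ ≤ _ := measureReal_biUnion_finset_le _ _
    _ ≤ ∑ S ∈ powersetCard k (univ : Finset (Fin n)), ℓ * (1 - q ^ k) ^ m :=
        sum_le_sum fun S hS => pi_real_no_stars_le ν hν (mem_powersetCard.1 hS).2 hn
    _ = n.choose k * (ℓ * (1 - q ^ k) ^ m) := by simp
    _ ≤ _ := by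
        gcongr
        exact_mod_cast Nat.choose_le_pow n k

end Upper

/-! ### An isolated set exists below the threshold -/

section Lower

theorem hasIsolatedSet_labelGraph {X : Type*} {n k m : ℕ} {A : Set X} {f : Sym2 (Fin n) → X} {u : Fin m × Fin k ↪ Fin n}
    (hk : 0 < k) {i : Fin m} (hind : ∀ x y, x ≠ y → f s(u x, u y) ∉ A)
    (hi : ∀ w : {w // w ∉ Set.range u}, ∃ j, f s(u (i, j), (w : Fin n)) ∉ A) :
    HasIsolatedSet k (labelGraph A f) := by
  have hadj : ∀ x y, ¬ (labelGraph A f).Adj (u x) (u y) := by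
    intro x y h
    rw [labelGraph_adj] at h
    exact hind x y (fun hxy => h.2 (congrArg u hxy)) h.1
  refine ⟨univ.map ⟨fun j => u (i, j), fun j j' h => congrArg Prod.snd (u.injective h)⟩,
    by simp, ?_, fun v => ?_⟩
  · simp only [Finset.mem_map, mem_univ, true_and]
    rintro _ ⟨j, rfl⟩ _ ⟨j', rfl⟩
    exact hadj _ _
  · simp only [Finset.mem_map, mem_univ, true_and, exists_exists_eq_and]
    -- The whole range of `u` is independent, so only vertices outside it could be common neighbors.
    by_cases hv : v ∈ Set.range u
    · obtain ⟨x, rfl⟩ := hv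
      exact ⟨⟨0, hk⟩, hadj _ _⟩
    · obtain ⟨j, hj⟩ := hi ⟨v, hv⟩
      exact ⟨j, fun h => hj (labelGraph_adj.1 h).1⟩

variable {X : Type*} [Finite X] [MeasurableSpace X] [MeasurableSingletonClass X] (ν : Measure X)
  [IsProbabilityMeasure ν] {n k m : ℕ}

theorem pi_real_exists_adj_le (A : Set X) (u : Fin m × Fin k ↪ Fin n) :
    (Measure.pi fun _ : Sym2 (Fin n) => ν).real {f | ∃ x y, x ≠ y ∧ f s(u x, u y) ∈ A} ≤
      (k * m : ℝ) ^ 2 * ν.real A := by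
  classical
  have hsub : {f : Sym2 (Fin n) → X | ∃ x y, x ≠ y ∧ f s(u x, u y) ∈ A} ⊆
      ⋃ z ∈ (univ : Finset ((Fin m × Fin k) × (Fin m × Fin k))), {f | f s(u z.1, u z.2) ∈ A} := by
    rintro f ⟨x, y, -, h⟩
    exact Set.mem_biUnion (mem_coe.2 (mem_univ (x, y))) h
  calc _ ≤ _ := measureReal_mono hsub (measure_ne_top _ _)
    _ ≤ _ := measureReal_biUnion_finset_le _ _
    _ = _ := by
      simp only [pi_real_eval, sum_const, card_univ, Fintype.card_prod, Fintype.card_fin,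
        nsmul_eq_mul]
      push_cast
      ring

theorem pi_real_no_common_neighbor (A : Set X) (u : Fin m × Fin k ↪ Fin n) (i : Fin m) :
    (Measure.pi fun _ : Sym2 (Fin n) => ν).real
      {f | ∀ w : {w // w ∉ Set.range u}, ∃ j, f s(u (i, j), (w : Fin n)) ∉ A} =
      (1 - ν.real A ^ k) ^ (n - m * k) := by
  classical
  have hset : {f : Sym2 (Fin n) → X |
      ∀ w : {w // w ∉ Set.range u}, ∃ j, f s(u (i, j), (w : Fin n)) ∉ A} =
      ⋂ w : {w // w ∉ Set.range u}, {f | ∀ j, f s(u (i, j), (w : Fin n)) ∈ A}ᶜ := by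
    ext f
    simp
  rw [hset, pi_real_iInter ν fun w : {w // w ∉ Set.range u} => univ.image fun j => s(u (i, j), (w : Fin n))]
  · simp_rw [pi_real_compl]
    have : ∀ w : {w // w ∉ Set.range u}, (Measure.pi fun _ : Sym2 (Fin n) => ν).real
        {f | ∀ j, f s(u (i, j), (w : Fin n)) ∈ A} = ν.real A ^ k := by
      intro w
      rw [pi_real_forall_mem ν (e := fun j => s(u (i, j), (w : Fin n)))
        ((sym2_mk_left_injective _).comp fun j j' h => congrArg Prod.snd (u.injective h))]
      simp
    simp only [this, prod_const, card_univ]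
    congr 1
    have hc := Fintype.card_subtype_compl (fun w => w ∈ Set.range u)
    rw [hc, Fintype.card_fin]
    congr 1
    change Fintype.card (Set.range u) = _
    rw [Set.card_range_of_injective u.injective]
    simp
  · intro w w' hww
    rw [disjoint_left]
    intro e he he'
    obtain ⟨j, -, rfl⟩ := mem_image.1 he
    obtain ⟨j', -, hst⟩ := mem_image.1 he'
    rcases Sym2.eq_iff.1 hst with ⟨_, h⟩ | ⟨h, _⟩
    · exact hww (Subtype.ext h.symm)
    · exact w.2 ⟨_, h⟩
  · intro w f f' hff hf hf'
    refine hf fun j => ?_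
    rw [hff _ (mem_image_of_mem _ (mem_univ j))]
    exact hf' j

/-- If no block of `u` is isolated, then either an edge lies inside the range of `u`, which a union
bound controls, or every block has a common neighbor outside the range. The latter events are
independent, because the pairs from different blocks to vertices outside the range are different. -/
theorem pi_real_not_hasIsolatedSet_le (A : Set X) (hk : 0 < k) (hn : m * k ≤ n) :
    (Measure.pi fun _ : Sym2 (Fin n) => ν).real
      {f | ¬ HasIsolatedSet k (labelGraph A f)} ≤
      (k * m : ℝ) ^ 2 * ν.real A + (1 - (1 - ν.real A ^ k) ^ n) ^ m := by
  classical
  set μ := Measure.pi fun _ : Sym2 (Fin n) => ν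
  obtain ⟨u⟩ : Nonempty (Fin m × Fin k ↪ Fin n) := by
    rw [Function.Embedding.nonempty_iff_card_le]
    simpa using hn
  have hsub : {f | ¬ HasIsolatedSet k (labelGraph A f)} ⊆
      {f | ∃ x y, x ≠ y ∧ f s(u x, u y) ∈ A} ∪
      ⋂ i, {f | ∀ w : {w // w ∉ Set.range u}, ∃ j, f s(u (i, j), (w : Fin n)) ∉ A}ᶜ := by
    intro f hf
    by_contra hcon
    rw [Set.mem_union, not_or, Set.mem_iInter, not_forall] at hcon
    obtain ⟨h1, i, h2⟩ := hcon
    exact hf (hasIsolatedSet_labelGraph hk (fun x y hxy h => h1 ⟨x, y, hxy, h⟩) (not_not.1 h2))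
  have hp0 : 0 ≤ 1 - ν.real A ^ k :=
    sub_nonneg.2 (pow_le_one₀ measureReal_nonneg measureReal_le_one)
  have hp1 : 1 - ν.real A ^ k ≤ 1 := sub_le_self _ (by positivity)
  have hinter : μ.real
      (⋂ i, {f | ∀ w : {w // w ∉ Set.range u}, ∃ j, f s(u (i, j), (w : Fin n)) ∉ A}ᶜ) ≤
      (1 - (1 - ν.real A ^ k) ^ n) ^ m := by
    rw [pi_real_iInter ν fun i => univ.image
      fun z : Fin k × {w // w ∉ Set.range u} => s(u (i, z.1), (z.2 : Fin n))]
    · simp_rw [pi_real_compl, pi_real_no_common_neighbor]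
      rw [prod_const, card_univ, Fintype.card_fin]
      refine pow_le_pow_left₀ (sub_nonneg.2 (pow_le_one₀ hp0 hp1)) ?_ m
      exact sub_le_sub_left (pow_le_pow_of_le_one hp0 hp1 (Nat.sub_le _ _)) 1
    · intro i i' hii
      rw [disjoint_left]
      intro e he he'
      obtain ⟨z, -, rfl⟩ := mem_image.1 he
      obtain ⟨z', -, hst⟩ := mem_image.1 he'
      rcases Sym2.eq_iff.1 hst with ⟨h, _⟩ | ⟨h, _⟩
      · exact hii (congrArg Prod.fst (u.injective h)).symm
      · exact z.2.2 ⟨_, h⟩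
    · intro i f f' hff hf hf'
      refine hf fun w => ?_
      obtain ⟨j, hj⟩ := hf' w
      refine ⟨j, ?_⟩
      rw [hff _ (mem_image_of_mem _ (mem_univ (j, w)))]
      exact hj
  exact (measureReal_mono hsub (measure_ne_top _ _)).trans ((measureReal_union_le _ _).trans
    (add_le_add (pi_real_exists_adj_le ν A u) hinter))

end Lower

/-! ### Transfer of both bounds to the model with `M` edges -/

theorem probGnM_le_one (n M : ℕ) (Q : SimpleGraph (Fin n) → Prop) : probGnM n M Q ≤ 1 := by
  rw [probGnM_eq_levelDensity]
  exact levelDensity_le_one _ _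

theorem probGnM_mono {n : ℕ} (M : ℕ) {Q Q' : SimpleGraph (Fin n) → Prop} (h : ∀ G, Q G → Q' G) :
    probGnM n M Q ≤ probGnM n M Q' := by
  rw [probGnM_eq_levelDensity, probGnM_eq_levelDensity]
  exact levelDensity_mono (fun F => h _) M

/-- There is a distribution on `Bool × Fin k` whose first coordinate is `true` with probability `p`
and whose second coordinate is independent and uniform. -/
theorem exists_measure_bool_fin {k : ℕ} (hk : 0 < k) {p : ℝ} (hp : 0 ≤ p) (hp1 : p ≤ 1) :
    ∃ ν : Measure (Bool × Fin k), IsProbabilityMeasure ν ∧ (∀ c, ν.real {(true, c)} = p / k) ∧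
      ν.real (Prod.fst ⁻¹' {true}) = p := by
  have : Nonempty (Fin k) := ⟨⟨0, hk⟩⟩
  let β : Measure Bool :=
    ENNReal.ofReal p • Measure.dirac true + ENNReal.ofReal (1 - p) • Measure.dirac false
  have hβ : IsProbabilityMeasure β := by
    constructor
    simp only [β, Measure.add_apply, Measure.smul_apply, measure_univ, smul_eq_mul, mul_one]
    rw [← ENNReal.ofReal_add hp (by linarith)]
    simp
  have hβt : β.real {true} = p := by
    simp [β, measureReal_def, hp]
  let γ : Measure (Fin k) := (PMF.uniformOfFintype (Fin k)).toMeasure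
  have hγ : ∀ c, γ.real {c} = (k : ℝ)⁻¹ := by
    intro c
    simp [γ, measureReal_def]
  refine ⟨β.prod γ, inferInstance, fun c => ?_, ?_⟩
  · rw [← Set.singleton_prod_singleton, measureReal_prod_prod, hβt, hγ, div_eq_mul_inv]
  · rw [← Set.prod_univ, measureReal_prod_prod, hβt, probReal_univ, mul_one]

theorem one_sub_probGnM_isStarColorable_le {n k ℓ m M : ℕ} (hk : 0 < k) (hn : k + ℓ * m ≤ n)
    {p : ℝ} (hp : 0 ≤ p) (hp1 : p ≤ 1) (hM : 2 * (n.choose 2 * p) ≤ M) (hM' : M ≤ n.choose 2) :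
    1 - probGnM n M (IsStarColorable k ℓ) ≤
      2 * ((n : ℝ) ^ k * (ℓ * (1 - (p / k) ^ k) ^ m)) := by
  obtain ⟨ν, hν, hνc, hνA⟩ := exists_measure_bool_fin hk hp hp1
  rw [probGnM_eq_levelDensity, sub_eq_of_eq_add' (levelDensity_add_not
    (fun F : Finset (EdgeSlot n) => IsStarColorable k ℓ (graphOfEdges F))
      (hM'.trans_eq (card_edgeSlot n).symm)).symm]
  refine (levelDensity_le_two_mul_binomialProb
    (fun F F' h hF' hF => hF' (hF.mono (graphOfEdges_mono h))) hp hp1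
    (by rwa [card_edgeSlot])).trans ?_
  have h := pi_real_labelGraph (n := n) ν (Prod.fst ⁻¹' {true}) (fun G => ¬ IsStarColorable k ℓ G)
  rw [hνA] at h
  rw [← h]
  gcongr
  exact pi_real_not_isStarColorable_le ν hνc hn hk

theorem one_sub_probGnM_hasIsolatedSet_le {n k m M : ℕ} (hk : 0 < k) (hn : m * k ≤ n)
    {p : ℝ} (hp : 0 ≤ p) (hp1 : p ≤ 1) (hM : 4 * (M : ℝ) ≤ n.choose 2 * p) :
    1 - probGnM n M (HasIsolatedSet k) ≤
      2 * ((k * m : ℝ) ^ 2 * p + (1 - (1 - p ^ k) ^ n) ^ m) := by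
  obtain ⟨ν, hν, -, hνA⟩ := exists_measure_bool_fin hk hp hp1
  rw [probGnM_eq_levelDensity]
  refine (one_sub_levelDensity_le_two_mul
    (fun F F' h hF' => hF'.anti (graphOfEdges_mono h)) hp hp1 (by rwa [card_edgeSlot])).trans ?_
  rw [sub_eq_of_eq_add' (binomialProb_add_not p
    fun F : Finset (EdgeSlot n) => HasIsolatedSet k (graphOfEdges F)).symm]
  have h := pi_real_labelGraph (n := n) ν (Prod.fst ⁻¹' {true}) (fun G => ¬ HasIsolatedSet k G)
  rw [hνA] at h
  rw [← h]
  gcongr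
  have h' := pi_real_not_hasIsolatedSet_le (n := n) (m := m) ν (Prod.fst ⁻¹' {true}) hk hn
  rwa [hνA] at h'

/-! ### Choice of parameters and limits -/

section Asymptotics

/-- The order of magnitude of the edge probability at the threshold. -/
noncomputable def edgeRate (k n : ℕ) : ℝ := (Real.log n / n) ^ (1 / (k : ℝ))

theorem log_div_nonneg (n : ℕ) : 0 ≤ Real.log n / n :=
  div_nonneg (Real.log_natCast_nonneg n) (Nat.cast_nonneg n)

theorem edgeRate_nonneg (k n : ℕ) : 0 ≤ edgeRate k n := Real.rpow_nonneg (log_div_nonneg n) _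

theorem edgeRate_pow {k : ℕ} (hk : k ≠ 0) (n : ℕ) : edgeRate k n ^ k = Real.log n / n := by
  rw [edgeRate, one_div, Real.rpow_inv_natCast_pow (log_div_nonneg n) hk]

theorem tendsto_log_div : Tendsto (fun n : ℕ => Real.log n / n) atTop (𝓝 0) := by
  have h := (Real.isLittleO_log_id_atTop.tendsto_div_nhds_zero).comp tendsto_natCast_atTop_atTop
  exact h

theorem tendsto_edgeRate {k : ℕ} (hk : 0 < k) : Tendsto (edgeRate k) atTop (𝓝 0) := by
  have hpos : (0 : ℝ) < 1 / k := by positivity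
  have h := tendsto_log_div.rpow_const (p := 1 / (k : ℝ)) (Or.inr hpos.le)
  rwa [Real.zero_rpow hpos.ne'] at h

theorem one_lt_base {k : ℕ} (hk : 2 ≤ k) :
    1 < (k : ℝ) ^ k / ((k : ℝ) ^ k - (k.factorial : ℝ)) := by
  have h1 : (k.factorial : ℝ) < (k : ℝ) ^ k := by
    obtain ⟨j, rfl⟩ := Nat.exists_eq_add_of_le' hk
    have h : (j + 2).factorial < (j + 2) ^ (j + 2) := by
      rw [Nat.factorial_succ, pow_succ']
      have h2 := Nat.factorial_le_pow (j + 1)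
      have h3 : (j + 1) ^ (j + 1) < (j + 2) ^ (j + 1) := Nat.pow_lt_pow_left (by omega) (by omega)
      exact Nat.mul_lt_mul_of_pos_left (h2.trans_lt h3) (by omega)
    exact_mod_cast h
  have h2 : (0 : ℝ) < k.factorial := by exact_mod_cast k.factorial_pos
  rw [one_lt_div (by linarith)]
  linarith

/-- The radicand is `(n ^ 2) ^ k * (log n / n) / log a`, so `a` contributes only a constant factor.
-/
theorem threshold_eq {k : ℕ} (hk : 0 < k) {a : ℝ} (ha : 1 < a) {n : ℕ} (hn : 0 < n) :
    ((n : ℝ) ^ (2 * k - 1) * Real.logb a n) ^ (1 / (k : ℝ)) =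
      n ^ 2 * edgeRate k n / (Real.log a) ^ (1 / (k : ℝ)) := by
  have hn' : (0 : ℝ) < n := by exact_mod_cast hn
  have h1 : (n : ℝ) ^ (2 * k - 1) * Real.logb a n =
      ((n : ℝ) ^ 2) ^ k * (Real.log n / n) / Real.log a := by
    rw [Real.logb, ← pow_mul, ← Nat.sub_add_cancel (show 1 ≤ 2 * k by omega), pow_succ,
      Nat.add_sub_cancel]
    field_simp
  have h2 : 0 ≤ Real.log n / n := log_div_nonneg n
  rw [h1, Real.div_rpow (by positivity) (Real.log_pos ha).le, Real.mul_rpow (by positivity) h2,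
    one_div, Real.pow_rpow_inv_natCast (by positivity) hk.ne', edgeRate, one_div]

theorem tendsto_one_of_one_sub_le {f e : ℕ → ℝ} (hf : ∀ n, f n ≤ 1)
    (he : Tendsto e atTop (𝓝 0)) (h : ∀ᶠ n in atTop, 1 - f n ≤ e n) :
    Tendsto f atTop (𝓝 1) := by
  have h1 : Tendsto (fun n => 1 - e n) atTop (𝓝 1) := by simpa using he.const_sub 1
  refine tendsto_of_tendsto_of_tendsto_of_le_of_le' h1 tendsto_const_nhds ?_ (.of_forall hf)
  filter_upwards [h] with n hn
  linarith

theorem tendsto_probGnM_rainbowIndex_le {k ℓ : ℕ} (hk : 0 < k) (hℓ : 1 ≤ ℓ) {M : ℕ → ℕ}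
    (hM : ∀ᶠ n in atTop, M n ≤ n.choose 2)
    (hM' : ∀ᶠ n : ℕ in atTop,
      n ^ 2 * (k * (2 * ℓ * (k + 1)) ^ (1 / (k : ℝ)) * edgeRate k n) ≤ M n) :
    Tendsto (fun n => probGnM n (M n) fun G => rainbowIndex k ℓ G ≤ k) atTop (𝓝 1) := by
  have hk' : (0 : ℝ) < k := by exact_mod_cast hk
  have hℓ' : (0 : ℝ) < ℓ := by exact_mod_cast hℓ
  -- Chosen so that `m ≥ n / (2ℓ)` candidates per block give `m * (p / k) ^ k ≥ (k + 1) * log n`: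
  -- this beats the `n ^ k` sets and leaves a factor `1 / n`.
  set K : ℝ := k * (2 * ℓ * (k + 1)) ^ (1 / (k : ℝ))
  have hKpow : (K / k) ^ k = 2 * ℓ * (k + 1) := by
    rw [mul_div_cancel_left₀ _ hk'.ne', one_div, Real.rpow_inv_natCast_pow (by positivity) hk.ne']
  have hK : 0 ≤ K := by positivity
  have hp1 : ∀ᶠ n in atTop, K * edgeRate k n ≤ 1 := by
    have := (tendsto_edgeRate hk).const_mul K
    rw [mul_zero] at this
    exact this.eventually_le_const one_pos
  refine tendsto_one_of_one_sub_le (fun n => probGnM_le_one _ _ _)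
    (e := fun n => 2 * ℓ / n) (tendsto_const_div_atTop_nhds_zero_nat _) ?_
  filter_upwards [hM, hM', hp1, eventually_ge_atTop (2 * (k + ℓ))] with n h1 h2 h3 h4
  have hn : (0 : ℝ) < n := by
    have : 0 < n := by omega
    exact_mod_cast this
  set p := K * edgeRate k n
  have hp : 0 ≤ p := mul_nonneg hK (edgeRate_nonneg k n)
  have hpk : (p / k) ^ k = 2 * ℓ * (k + 1) * (Real.log n / n) := by
    rw [mul_div_right_comm, mul_pow, hKpow, edgeRate_pow hk.ne']
  set m := (n - k) / ℓ
  have hm : ℓ * m ≤ n - k := Nat.mul_div_le _ _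
  have hm' : (n : ℝ) ≤ 2 * (ℓ * m) := by
    have h5 : n - k < ℓ * m + ℓ := Nat.lt_mul_div_succ (n - k) hℓ
    have h6 : n ≤ 2 * (ℓ * m) := by omega
    exact_mod_cast h6
  have hchoose : 2 * (n.choose 2 * p) ≤ M n := by
    refine le_trans ?_ h2
    rw [Nat.cast_choose_two]
    nlinarith
  have hbound := one_sub_probGnM_isStarColorable_le (ℓ := ℓ) hk (by omega : k + ℓ * m ≤ n)
    hp h3 hchoose h1
  have hmono := probGnM_mono (n := n) (M n) fun G (hG : IsStarColorable k ℓ G) => hG.rainbowIndex_le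
  refine (sub_le_sub_left hmono 1).trans (hbound.trans ?_)
  have hexp : (1 - (p / k) ^ k) ^ m ≤ ((n : ℝ) ^ (k + 1))⁻¹ := by
    have hle1 : (p / k) ^ k ≤ 1 := by
      refine pow_le_one₀ (by positivity) ((div_le_one hk').2 (h3.trans ?_))
      exact_mod_cast hk
    calc (1 - (p / k) ^ k) ^ m ≤ (Real.exp (-(p / k) ^ k)) ^ m := by
          gcongr
          exact Real.one_sub_le_exp_neg _
      _ = Real.exp (m * -(p / k) ^ k) := by rw [Real.exp_nat_mul]
      _ ≤ Real.exp (-((k + 1 : ℕ) * Real.log n)) := by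
          apply Real.exp_le_exp.2
          rw [hpk]
          have hlog := log_div_nonneg n
          have h7 : (k + 1) * (n * (Real.log n / n)) ≤
              (k + 1) * (2 * (ℓ * m) * (Real.log n / n)) := by gcongr
          rw [mul_div_cancel₀ _ hn.ne'] at h7
          push_cast
          linarith
      _ = ((n : ℝ) ^ (k + 1))⁻¹ := by
          rw [Real.exp_neg, Real.exp_nat_mul, Real.exp_log hn]
  calc 2 * ((n : ℝ) ^ k * (ℓ * (1 - (p / k) ^ k) ^ m))
      ≤ 2 * ((n : ℝ) ^ k * (ℓ * ((n : ℝ) ^ (k + 1))⁻¹)) := by gcongr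
    _ = 2 * ℓ / n := by
      rw [pow_succ]
      field_simp

theorem exp_neg_two_mul_le {x : ℝ} (hx : 0 ≤ x) (hx' : x ≤ 1 / 2) :
    Real.exp (-(2 * x)) ≤ 1 - x := by
  rw [Real.exp_neg]
  have h1 := Real.add_one_le_exp (2 * x)
  refine (inv_anti₀ (by linarith) h1).trans ?_
  rw [inv_le_iff_one_le_mul₀ (by linarith)]
  nlinarith

theorem tendsto_sqrt_mul_log_div :
    Tendsto (fun n : ℕ => (n : ℝ) ^ (1 / 2 : ℝ) * (Real.log n / n)) atTop (𝓝 0) := by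
  have h := ((isLittleO_log_rpow_atTop (r := 1 / 2) (by norm_num)).tendsto_div_nhds_zero).comp
    tendsto_natCast_atTop_atTop
  refine h.congr' ?_
  filter_upwards [eventually_gt_atTop 0] with n hn
  have hn' : (0 : ℝ) < n := by exact_mod_cast hn
  have h1 : (n : ℝ) = (n : ℝ) ^ (1 / 2 : ℝ) * (n : ℝ) ^ (1 / 2 : ℝ) := by
    rw [← Real.rpow_add hn']; norm_num
  have h2 : (0 : ℝ) < (n : ℝ) ^ (1 / 2 : ℝ) := by positivity
  change Real.log n / (n : ℝ) ^ (1 / 2 : ℝ) = _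
  rw [← mul_div_assoc, div_eq_div_iff h2.ne' hn'.ne']
  nth_rw 2 [h1]
  ring

theorem tendsto_probGnM_not_rainbowIndex_le {k ℓ : ℕ} (hk : 2 ≤ k) (hℓ : 1 ≤ ℓ) {M : ℕ → ℕ}
    (hM : ∀ᶠ n : ℕ in atTop,
      16 * (M n : ℝ) ≤ n ^ 2 * ((1 / (16 * k)) ^ (1 / (k : ℝ)) * edgeRate k n)) :
    Tendsto (fun n => probGnM n (M n) fun G => ¬ rainbowIndex k ℓ G ≤ k) atTop (𝓝 1) := by
  have hk0 : 0 < k := by omega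
  have hk' : (0 : ℝ) < k := by exact_mod_cast hk0
  -- Makes `2 * n * p ^ k = log n / (8k)`, so a block is isolated from outside with probability at
  -- least `n ^ (-1 / (8k))`.
  set K : ℝ := (1 / (16 * k)) ^ (1 / (k : ℝ))
  have hKpow : K ^ k = 1 / (16 * k) := by
    simp only [K]
    rw [one_div (k : ℝ), Real.rpow_inv_natCast_pow (by positivity) hk0.ne']
  have hK : 0 ≤ K := by positivity
  have hp1 : ∀ᶠ n in atTop, K * edgeRate k n ≤ 1 := by
    have := (tendsto_edgeRate hk0).const_mul K
    rw [mul_zero] at this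
    exact this.eventually_le_const one_pos
  have hsqrt : ∀ᶠ n : ℕ in atTop, (k : ℝ) ≤ (n : ℝ) ^ (1 / 2 : ℝ) :=
    ((tendsto_rpow_atTop (by norm_num)).comp tendsto_natCast_atTop_atTop).eventually_ge_atTop _
  have he1 : Tendsto (fun n : ℕ => k ^ 2 * K *
      ((n : ℝ) ^ (1 / 2 : ℝ) * (Real.log n / n)) ^ (1 / (k : ℝ))) atTop (𝓝 0) := by
    have hpos : (0 : ℝ) < 1 / k := by positivity
    have h := (tendsto_sqrt_mul_log_div.rpow_const (p := 1 / (k : ℝ)) (Or.inr hpos.le)).const_mul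
      ((k : ℝ) ^ 2 * K)
    rwa [Real.zero_rpow hpos.ne', mul_zero] at h
  have he2 : Tendsto (fun n : ℕ => Real.exp (1 - (n : ℝ) ^ (1 / (8 * k) : ℝ))) atTop (𝓝 0) := by
    refine Real.tendsto_exp_atBot.comp (tendsto_atBot_add_const_left _ 1 ?_)
    exact tendsto_neg_atTop_atBot.comp
      ((tendsto_rpow_atTop (by positivity)).comp tendsto_natCast_atTop_atTop)
  have he := (he1.add he2).const_mul 2
  rw [add_zero, mul_zero] at he
  refine tendsto_one_of_one_sub_le (fun n => probGnM_le_one _ _ _) he ?_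
  filter_upwards [hM, hp1, hsqrt, eventually_ge_atTop 2] with n h1 h2 h3 h4
  have hn2 : (2 : ℝ) ≤ n := by exact_mod_cast h4
  have hn : (0 : ℝ) < n := by linarith
  set p := K * edgeRate k n
  have hp : 0 ≤ p := mul_nonneg hK (edgeRate_nonneg k n)
  have hpk : p ^ k = Real.log n / n / (16 * k) := by
    rw [mul_pow, hKpow, edgeRate_pow hk0.ne']
    ring
  -- The number of blocks must satisfy `t ^ 2 * p → 0`, so that no edge joins their vertices, and `t
  -- * n ^ (-1 / (8k)) → ∞`, so that some block is isolated. The exponent `1 / (4k)` meets both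
  -- conditions.
  set t : ℝ := (n : ℝ) ^ (1 / (4 * k) : ℝ)
  have ht : 0 ≤ t := by positivity
  set m := ⌊t⌋₊
  have hmt : (m : ℝ) ≤ t := Nat.floor_le ht
  have htm : t < m + 1 := Nat.lt_floor_add_one t
  have hmk : m * k ≤ n := by
    have ht' : t ≤ (n : ℝ) ^ (1 / 2 : ℝ) := by
      refine Real.rpow_le_rpow_of_exponent_le (by linarith) ?_
      have : (1 : ℝ) ≤ k := by exact_mod_cast hk0
      gcongr
      linarith
    have : (m * k : ℝ) ≤ n := by
      calc (m * k : ℝ) ≤ (n : ℝ) ^ (1 / 2 : ℝ) * (n : ℝ) ^ (1 / 2 : ℝ) := by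
            gcongr
            exact hmt.trans ht'
        _ = n := by
          rw [← Real.rpow_add hn]; norm_num
    exact_mod_cast this
  have hchoose : 4 * (M n : ℝ) ≤ n.choose 2 * p := by
    rw [Nat.cast_choose_two]
    have : (n : ℝ) ^ 2 * p ≤ 4 * (n * (n - 1) / 2 * p) := by
      nlinarith [mul_nonneg (mul_nonneg hn.le hp) (sub_nonneg.2 hn2)]
    linarith
  have hbound := one_sub_probGnM_hasIsolatedSet_le hk0 hmk hp h2 hchoose
  have hmono := probGnM_mono (n := n) (M n)
    fun G (hG : HasIsolatedSet k G) => hG.lt_rainbowIndex hk hℓ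
  refine (sub_le_sub_left hmono 1).trans (hbound.trans ?_)
  refine mul_le_mul_of_nonneg_left (add_le_add ?_ ?_) zero_le_two
  · have ht2 : t ^ 2 = ((n : ℝ) ^ (1 / 2 : ℝ)) ^ (1 / (k : ℝ)) := by
      rw [← Real.rpow_natCast, ← Real.rpow_mul hn.le, ← Real.rpow_mul hn.le]
      congr 1
      push_cast
      field_simp
      norm_num
    rw [Real.mul_rpow (by positivity) (log_div_nonneg n), ← ht2]
    calc (k * m : ℝ) ^ 2 * p ≤ (k * t) ^ 2 * p := by gcongr
      _ = _ := by
        simp only [p, edgeRate]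
        ring
  · set q : ℝ := (n : ℝ) ^ (-(1 / (8 * k)) : ℝ)
    have hlog : Real.log n ≤ n := (Real.log_le_sub_one_of_pos hn).trans (by linarith)
    have hpk0 : 0 ≤ p ^ k := by positivity
    have hpk1 : p ^ k ≤ 1 / 2 := by
      rw [hpk, div_div, div_le_iff₀ (by positivity)]
      have : (1 : ℝ) ≤ k := by exact_mod_cast hk0
      nlinarith
    have hq : q ≤ (1 - p ^ k) ^ n := by
      calc q = (Real.exp (-(2 * p ^ k))) ^ n := by
            rw [← Real.exp_nat_mul, hpk]
            simp only [q]
            rw [Real.rpow_def_of_pos hn]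
            congr 1
            field_simp
            ring
        _ ≤ (1 - p ^ k) ^ n := by
            gcongr
            exact exp_neg_two_mul_le hpk0 hpk1
    have hq0 : 0 ≤ q := by positivity
    have hq1 : q ≤ 1 := hq.trans (pow_le_one₀ (by linarith) (by linarith))
    have hqt : q * t = (n : ℝ) ^ (1 / (8 * k) : ℝ) := by
      simp only [q, t]
      rw [← Real.rpow_add hn]
      congr 1
      field_simp
      norm_num
    calc (1 - (1 - p ^ k) ^ n) ^ m ≤ (Real.exp (-q)) ^ m := by
          gcongr
          · exact sub_nonneg.2 (pow_le_one₀ (by linarith) (by linarith))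
          · linarith [Real.one_sub_le_exp_neg q]
      _ = Real.exp (m * -q) := by rw [Real.exp_nat_mul]
      -- The summand `1` absorbs the rounding of `t` down to `m`, since `q ≤ 1`.
      _ ≤ Real.exp (1 - (n : ℝ) ^ (1 / (8 * k) : ℝ)) := by
          apply Real.exp_le_exp.2
          rw [← hqt]
          nlinarith

end Asymptotics

end RainbowIndex

/-! ### The sharp threshold -/

theorem mainTheorem2 (k ℓ : ℕ) (hk : 3 ≤ k) (hℓ : 1 ≤ ℓ) (a : ℝ)
    (ha : a = (k : ℝ) ^ k / ((k : ℝ) ^ k - (k.factorial : ℝ))) :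
    RainbowIndex.IsSharpThresholdGnM
      (fun _ G => RainbowIndex.rainbowIndex k ℓ G ≤ (k : ℕ∞))
      (fun n => ((n : ℝ) ^ (2 * k - 1) * Real.logb a (n : ℝ)) ^ (1 / (k : ℝ))) := by
  have hk0 : 0 < k := by omega
  have hk' : (0 : ℝ) < k := by exact_mod_cast hk0
  have hℓ' : (0 : ℝ) < ℓ := by exact_mod_cast hℓ
  have ha1 : 1 < a := ha ▸ RainbowIndex.one_lt_base (by omega)
  have hlog := Real.log_pos ha1
  set D : ℝ := (Real.log a) ^ (1 / (k : ℝ))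
  have hD : 0 < D := by positivity
  -- The factor `D` cancels the contribution of `log a`. The `16` combines the factor `4` from the
  -- model comparison with `n.choose 2 ≥ n ^ 2 / 4`.
  refine ⟨(1 / (16 * k)) ^ (1 / (k : ℝ)) * D / 16, k * (2 * ℓ * (k + 1)) ^ (1 / (k : ℝ)) * D,
    by positivity, by positivity, fun M _ hM => ?_, fun M hM hM' => ?_⟩
  · refine RainbowIndex.tendsto_probGnM_not_rainbowIndex_le (by omega) hℓ ?_
    filter_upwards [hM, eventually_gt_atTop 0] with n h hn
    rw [RainbowIndex.threshold_eq hk0 ha1 hn] at h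
    have : (1 / (16 * k) : ℝ) ^ (1 / (k : ℝ)) * D / 16 * (n ^ 2 * RainbowIndex.edgeRate k n / D) =
        n ^ 2 * ((1 / (16 * k) : ℝ) ^ (1 / (k : ℝ)) * RainbowIndex.edgeRate k n) / 16 := by
      field_simp
    linarith
  · refine RainbowIndex.tendsto_probGnM_rainbowIndex_le hk0 hℓ hM ?_
    filter_upwards [hM', eventually_gt_atTop 0] with n h hn
    rw [RainbowIndex.threshold_eq hk0 ha1 hn] at h
    refine le_of_eq_of_le ?_ h
    change _ = _ * D * (_ / D)
    field_simp
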